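/- For integers $n\ge 1$ and $q\ge 2$ let $F(n,q)$ be the set of all maps $[0,q[^n\to[0,q[^n$, where $[0,q[=\{0,\dots,q-1\}$. For $m\ge n$ let $\mathrm{pr}_{[n]}:[0,q[^m\to[0,q[^n$ be the projection on the first $n$ coordinates, and let $F^*(m,q)\subseteq F(m,q)$ be the set of maps that update at most one coordinate, i.e. of those $g$ for which there is at most one index $i$ such that $g(x)_i\neq x_i$ for some $x$. For $h\in F(n,q)$ and $m\ge n$ let $\mathcal L(h|m)$ be the smallest $t$ such that there are $g^{(1)},\dots,g^{(t)}\in F^*(m,q)$ with $\mathrm{pr}_{[n]}\circ g^{(t)}\circ\dots\circ g^{(1)}=h\circ \mathrm{pr}_{[n]}$, and let $\mathcal L^*(h)=\min\{\mathcal L(h|m) : m\ge n\}$ be the procedural complexity of $h$ with unlimited memory. For all $n,q\ge 2$ there is $h\in F(n,q)$ such that $\mathcal L^*(h)\ge n+\lfloor n/3\rfloor$. Furthermore, if $q\ge 4$, there is $h\in F(n,q)$ such that $\mathcal L^*(h)\ge n+\lfloor n/2-\log_q n\rfloor$. -/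

import Mathlib

namespace AutomataNetwork

/-- The set `[0,q[^n` of configurations of `n` automata over the alphabet `[0,q[`. -/
abbrev Config (n q : ℕ) : Type := Fin n → Fin q

/-- `F(n,q)`: the transformations of `[0,q[^n`. -/
abbrev Transformation (n q : ℕ) : Type := Config n q → Config n q

/-- The projection `pr_[n]` of a configuration of size `m ≥ n` on its first `n` coordinates. -/
def proj {n m q : ℕ} (hnm : n ≤ m) (z : Config m q) : Config n q :=
  fun i => z (Fin.castLE hnm i)

/-- The `i`-th coordinate function of `f` is trivial: `f_i(x) = x_i` for all `x`. -/
def IsTrivialCoord {n q : ℕ} (f : Transformation n q) (i : Fin n) : Prop :=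
  ∀ x : Config n q, f x i = x i

/-- `F*(m,q)`: the transformations which update at most one coordinate. -/
def instructions (m q : ℕ) : Set (Transformation m q) :=
  {g | {i : Fin m | ¬ IsTrivialCoord g i}.Subsingleton}

/-- The composition `g⁽ᵗ⁾ ∘ ⋯ ∘ g⁽¹⁾` of the list `[g⁽¹⁾, …, g⁽ᵗ⁾]`: the head is applied first. -/
def run {m q : ℕ} (gs : List (Transformation m q)) (z : Config m q) : Config m q :=
  gs.foldl (fun y g => g y) z

/-- `h` is computed in `t` steps by instructions of size `m ≥ n`: there are
`g⁽¹⁾, …, g⁽ᵗ⁾ ∈ F*(m,q)` with `pr_[n] ∘ g⁽ᵗ⁾ ∘ ⋯ ∘ g⁽¹⁾ = h ∘ pr_[n]`. -/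
def ComputedIn {n m q : ℕ} (h : Transformation n q) (hnm : n ≤ m) (t : ℕ) : Prop :=
  ∃ gs : List (Transformation m q), gs.length = t ∧ (∀ g ∈ gs, g ∈ instructions m q) ∧
    proj hnm ∘ run gs = h ∘ proj hnm

/-- The procedural complexity `L(h|m)`, the least `t` such that `h` is computed in `t` steps by
instructions of size `m`. (It would be `⊤` if there were no such `t`.) -/
noncomputable def proceduralComplexity {n m q : ℕ} (h : Transformation n q) (hnm : n ≤ m) : ℕ∞ :=
  ⨅ (t : ℕ) (_ : ComputedIn h hnm t), (t : ℕ∞)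

/-- The procedural complexity with unlimited memory, `L*(h) = min {L(h|m) | n ≤ m}`. -/
noncomputable def proceduralComplexityStar {n q : ℕ} (h : Transformation n q) : ℕ∞ :=
  ⨅ (m : ℕ) (hnm : n ≤ m), proceduralComplexity h hnm

/-- The transformation which updates the coordinate `i` according to `f`. -/
def updateAt {m q : ℕ} (f : Transformation m q) (i : Fin m) : Transformation m q :=
  fun z => Function.update z i (f z i)

theorem updateAt_mem {m q : ℕ} (f : Transformation m q) (i : Fin m) :
    updateAt f i ∈ instructions m q := by
  have key : ∀ a : Fin m, ¬ IsTrivialCoord (updateAt f i) a → a = i := by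
    intro a ha
    by_contra hne
    exact ha fun x => by simp [updateAt, hne]
  intro a ha b hb
  rw [key a ha, key b hb]

theorem run_updateAt {m q : ℕ} (f : Transformation m q) (S : Set (Fin m))
    (hS : ∀ z z' : Config m q, (∀ j ∉ S, z j = z' j) → ∀ i ∈ S, f z i = f z' i)
    (l : List (Fin m)) (hl : ∀ i ∈ l, i ∈ S) (z : Config m q) (j : Fin m) :
    run (l.map (updateAt f)) z j = if j ∈ l then f z j else z j := by
  induction l generalizing z with
  | nil => simp [run]
  | cons i l ih =>
    have hi : i ∈ S := hl i (by simp)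
    have h1 := ih (fun a ha => hl a (by simp [ha])) (updateAt f i z)
    have h2 : run ((i :: l).map (updateAt f)) z = run (l.map (updateAt f)) (updateAt f i z) := rfl
    rw [h2, h1]
    by_cases hj : j ∈ l
    · simp only [hj, if_true, List.mem_cons, or_true]
      refine hS _ _ (fun a ha => ?_) j (hl j (by simp [hj]))
      have : a ≠ i := fun e => ha (e ▸ hi)
      simp [updateAt, this]
    · by_cases hji : j = i
      · subst hji
        simp [hj, updateAt]
      · simp [hj, hji, updateAt]

/-- Every transformation is computed by some list of instructions, so `L*(h)` is a genuine minimum: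
with `2n` cells, copy the input and then write the output. -/
theorem proceduralComplexityStar_ne_top {n q : ℕ} (h : Transformation n q) :
    proceduralComplexityStar h ≠ ⊤ := by
  let f : Transformation (n + n) q := fun z =>
    Fin.addCases (fun i => h (fun k => z (Fin.natAdd n k)) i) (fun i => z (Fin.castAdd n i))
  let l₁ : List (Fin (n + n)) := (List.finRange n).map (Fin.natAdd n)
  let l₂ : List (Fin (n + n)) := (List.finRange n).map (Fin.castAdd n)
  have hdis : ∀ a b : Fin n, Fin.castAdd n a ≠ Fin.natAdd n b := by
    intro a b e
    have := congrArg Fin.val e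
    simp at this
    omega
  have hc : ComputedIn h (Nat.le_add_right n n) ((l₁ ++ l₂).map (updateAt f)).length := by
    refine ⟨_, rfl, ?_, ?_⟩
    · intro g hg
      obtain ⟨i, -, rfl⟩ := List.mem_map.1 hg
      exact updateAt_mem f i
    · funext z
      have h1 : ∀ j, run (l₁.map (updateAt f)) z j = if j ∈ l₁ then f z j else z j := by
        refine run_updateAt f {j | j ∈ l₁} ?_ l₁ (fun i hi => hi) z
        intro y y' hy i hi
        obtain ⟨a, -, rfl⟩ := List.mem_map.1 (show i ∈ l₁ from hi)
        simp only [f, Fin.addCases_right]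
        refine hy _ fun hmem => ?_
        obtain ⟨b, -, hb⟩ := List.mem_map.1 (show Fin.castAdd n a ∈ l₁ from hmem)
        exact hdis a b hb.symm
      have h2 : ∀ y j, run (l₂.map (updateAt f)) y j = if j ∈ l₂ then f y j else y j := by
        refine fun y => run_updateAt f {j | j ∈ l₂} ?_ l₂ (fun i hi => hi) y
        intro y y' hy i hi
        obtain ⟨a, -, rfl⟩ := List.mem_map.1 (show i ∈ l₂ from hi)
        simp only [f, Fin.addCases_left]
        congr 1
        funext k
        refine hy _ fun hmem => ?_
        obtain ⟨b, -, hb⟩ := List.mem_map.1 (show Fin.natAdd n k ∈ l₂ from hmem)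
        exact hdis b k hb
      have h3 : run ((l₁ ++ l₂).map (updateAt f)) z =
          run (l₂.map (updateAt f)) (run (l₁.map (updateAt f)) z) := by
        simp [run]
      funext i
      have hi : Fin.castAdd n i ∈ l₂ := by simp [l₂]
      have h4 : ∀ k, run (l₁.map (updateAt f)) z (Fin.natAdd n k) = z (Fin.castAdd n k) := by
        intro k
        rw [h1, if_pos (by simp [l₁])]
        exact Fin.addCases_right _
      change run ((l₁ ++ l₂).map (updateAt f)) z (Fin.castAdd n i) =
        h (fun k => z (Fin.castAdd n k)) i
      rw [h3, h2, if_pos hi]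
      simp only [f, Fin.addCases_left]
      congr 1
      funext k
      exact h4 k
  have hle : proceduralComplexityStar h ≤ (((l₁ ++ l₂).map (updateAt f)).length : ℕ∞) :=
    (iInf₂_le (n + n) (Nat.le_add_right n n)).trans (iInf₂_le _ hc)
  exact ne_top_of_le_ne_top (ENat.natCast_ne_top _) hle

end AutomataNetwork

namespace AutomataNetwork

open Finset

/-! The lower bound counts the states of a program halfway through. Stop it when exactly `k`
coordinates of a set `A` already hold their final value, and call these `U`. If a family `P` of more
than `q ^ (k - 1)` inputs varies only on `U`, and the outputs are distinct but vary only on `A \ U`,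
then neither the finished coordinates nor the untouched cells distinguish members of `P`. The
information must sit in at least `k` cells updated already and not finished, and these updates come
on top of one final update for each of the `n` coordinates (`add_le_of_computedIn`).

As `U` depends on the program, `h` must be bad for all `k`-subsets of `A` at once. With `#A = 2 *
k`, pairwise disjoint families `P U` exist by greedy choice when `4 ^ k ≤ q ^ (n - k)`, and on `P U`
the map `h` moves the content of `U` to `A \ U`. -/

theorem exists_coord {m q : ℕ} (hm : 0 < m) :
    ∃ c : Transformation m q → Fin m,
      ∀ g ∈ instructions m q, ∀ j, j ≠ c g → ∀ x, g x j = x j := by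
  have key : ∀ g : Transformation m q, ∃ i : Fin m,
      g ∈ instructions m q → ∀ j, j ≠ i → ∀ x, g x j = x j := by
    intro g
    by_cases hg : ∃ i, ¬ IsTrivialCoord g i
    · obtain ⟨i, hi⟩ := hg
      refine ⟨i, fun h j hj => ?_⟩
      by_contra hc
      exact hj (h (show ¬ IsTrivialCoord g j from hc) hi)
    · push Not at hg
      exact ⟨⟨0, hm⟩, fun _ j _ => hg j⟩
  choose c hc using key
  exact ⟨c, fun g hg => hc g hg⟩

theorem run_eq_of_notMem {m q : ℕ} {c : Transformation m q → Fin m}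
    (hc : ∀ g ∈ instructions m q, ∀ j, j ≠ c g → ∀ x, g x j = x j)
    (l : List (Transformation m q)) (hl : ∀ g ∈ l, g ∈ instructions m q)
    (j : Fin m) (hj : j ∉ l.map c) (x : Config m q) : run l x j = x j := by
  induction l generalizing x with
  | nil => rfl
  | cons g l ih =>
    simp only [List.map_cons, List.mem_cons, not_or] at hj
    change run l (g x) j = x j
    rw [ih (fun a ha => hl a (by simp [ha])) hj.2, hc g (hl g (by simp)) j hj.1]

theorem run_append {m q : ℕ} (l₁ l₂ : List (Transformation m q)) (x : Config m q) :
    run (l₁ ++ l₂) x = run l₂ (run l₁ x) := by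
  simp [run]

/-- Configurations which agree outside `W` number at most `q ^ #W`. -/
theorem card_le_pow_of_agree {m q : ℕ} (P : Finset (Config m q)) (W : Finset (Fin m))
    (h : ∀ x ∈ P, ∀ y ∈ P, ∀ i ∉ W, x i = y i) : #P ≤ q ^ #W := by
  have h1 : #P ≤ #(univ : Finset (W → Fin q)) := by
    refine card_le_card_of_injOn (fun x i => x i) (by simp) ?_
    intro x hx y hy hxy
    funext i
    by_cases hi : i ∈ W
    · exact congrFun hxy ⟨i, hi⟩
    · exact h x hx y hy i hi
  simpa using h1

/-- A sequence of naturals increasing by at most one per step takes every intermediate value. -/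
theorem exists_eq_of_step_le {f : ℕ → ℕ} (h0 : f 0 = 0) (hf : ∀ s, f (s + 1) ≤ f s + 1)
    {k : ℕ} (t : ℕ) (ht : k ≤ f t) : ∃ s ≤ t, f s = k := by
  induction t with
  | zero => exact ⟨0, le_rfl, by omega⟩
  | succ t ih =>
    by_cases h : k ≤ f t
    · obtain ⟨s, hs, hk⟩ := ih h
      exact ⟨s, by omega, hk⟩
    · exact ⟨t + 1, le_rfl, by have := hf t; omega⟩

/-! ### Counting the states of a stopped program -/

/-- If every `k`-subset `U` of `A` comes with a large set of configurations that agree outside `U`,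
whose images are distinct but agree outside `A \ U`, then every program for `h` has length at least
`n + k`. -/
theorem add_le_of_computedIn {n m q k : ℕ} (hn : 0 < n) (hq : 0 < q) (h : Transformation n q)
    (hnm : n ≤ m) (A : Finset (Fin n)) (hA : k ≤ #A) (hnt : ∀ i, ¬ IsTrivialCoord h i)
    (hP : ∀ U ⊆ A, #U = k → ∃ P : Finset (Config n q), (∀ w, #P ≤ q ^ w → k ≤ w) ∧
      (∀ x ∈ P, ∀ y ∈ P, ∀ i ∉ U, x i = y i) ∧
      (∀ x ∈ P, ∀ y ∈ P, ∀ i ∉ A \ U, h x i = h y i) ∧ Set.InjOn h P)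
    {t : ℕ} (ht : ComputedIn h hnm t) : n + k ≤ t := by
  obtain ⟨gs, rfl, hgs, hrun⟩ := ht
  obtain ⟨c, hc⟩ := exists_coord (m := m) (q := q) (by omega)
  let ι : Fin n ↪ Fin m := Fin.castLEEmb hnm
  let ext : Config n q → Config m q := fun x j =>
    if hj : (j : ℕ) < n then x ⟨j, hj⟩ else ⟨0, hq⟩
  have hext : ∀ x i, ext x (ι i) = x i := fun x i => by simp [ext, ι]
  have hrun' : ∀ x i, run gs (ext x) (ι i) = h x i := fun x i => by
    have h1 := congrFun (congrFun hrun (ext x)) i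
    have h2 : proj hnm (ext x) = x := funext fun i => hext x i
    simp only [Function.comp_apply, h2] at h1
    exact h1
  -- coordinates updated before and after time `s`, and those holding their final value
  let B : ℕ → Finset (Fin m) := fun s => ((gs.take s).map c).toFinset
  let D : ℕ → Finset (Fin m) := fun s => ((gs.drop s).map c).toFinset
  let I : ℕ → Finset (Fin n) := fun s => univ.filter fun i => ι i ∉ D s
  have hmemI : ∀ s i, i ∈ I s ↔ ι i ∉ D s := fun s i => by simp [I]
  -- A coordinate that is never updated would make `h` trivial there.
  have hall : ∀ i, ι i ∈ gs.map c := by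
    intro i
    by_contra hi
    refine hnt i fun x => ?_
    rw [← hrun' x i, run_eq_of_notMem hc gs hgs _ hi, hext]
  have hBD : ∀ s i, ι i ∈ B s ∨ ι i ∈ D s := by
    intro s i
    have h1 := hall i
    rw [← List.take_append_drop s gs, List.map_append, List.mem_append] at h1
    simpa only [B, D, List.mem_toFinset] using h1
  have hI0 : I 0 = ∅ := by
    ext i
    have := hall i
    simp only [hmemI, D, List.drop_zero, List.mem_toFinset, this, not_true_eq_false, notMem_empty]
  have hIt : I gs.length = univ := by
    ext i
    simp only [hmemI, D, List.drop_length, List.map_nil, List.toFinset_nil, notMem_empty,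
      not_false_eq_true, mem_univ]
  have hstep : ∀ s, #(A ∩ I (s + 1)) ≤ #(A ∩ I s) + 1 := by
    intro s
    by_cases hs : s < gs.length
    · have hD : D s = insert (c gs[s]) (D (s + 1)) := by
        simp only [D]
        rw [List.drop_eq_getElem_cons hs, List.map_cons, List.toFinset_cons]
      by_cases hex : ∃ i, ι i = c gs[s]
      · obtain ⟨i₀, hi₀⟩ := hex
        refine (card_le_card (t := insert i₀ (A ∩ I s)) fun i hi => ?_).trans (card_insert_le _ _)
        rw [mem_inter, hmemI] at hi
        rw [mem_insert, mem_inter, hmemI, hD, mem_insert, ← hi₀]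
        by_cases he : i = i₀
        · exact Or.inl he
        · refine Or.inr ⟨hi.1, ?_⟩
          rintro (h1 | h1)
          · exact he (ι.injective h1)
          · exact hi.2 h1
      · refine (card_le_card fun i hi => ?_).trans (Nat.le_succ _)
        rw [mem_inter, hmemI] at hi
        rw [mem_inter, hmemI, hD, mem_insert]
        refine ⟨hi.1, ?_⟩
        rintro (h1 | h1)
        · exact hex ⟨i, h1⟩
        · exact hi.2 h1
    · have : I (s + 1) = I s := by
        simp only [I, D]
        rw [List.drop_of_length_le (by omega), List.drop_of_length_le (by omega)]
      rw [this]
      exact Nat.le_succ _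
  obtain ⟨s, hs, hk⟩ := exists_eq_of_step_le (f := fun s => #(A ∩ I s)) (by simp [hI0]) hstep
    gs.length (k := k) (by simpa [hIt] using hA)
  obtain ⟨P, hPk, hPU, hPh, hinj⟩ := hP (A ∩ I s) inter_subset_left hk
  let z : Config n q → Config m q := fun x => run (gs.take s) (ext x)
  have hz : ∀ x, run (gs.drop s) (z x) = run gs (ext x) := fun x => by
    rw [← run_append, List.take_append_drop]
  have hzinj : Set.InjOn z P := by
    intro x hx y hy hxy
    refine hinj hx hy (funext fun i => ?_)
    rw [← hrun', ← hrun', ← hz, ← hz, hxy]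
  -- Only cells in `W` can distinguish the states `z x` for `x ∈ P`: cells of `I s` hold output
  -- values, constant on `P`, and all others outside `B s` hold input values, constant because `U ⊆
  -- I s`.
  let W : Finset (Fin m) := B s \ (I s).map ι
  have hW : #(P.image z) ≤ q ^ #W := by
    refine card_le_pow_of_agree _ _ ?_
    intro a ha b hb j hj
    obtain ⟨x, hx, rfl⟩ := mem_image.1 ha
    obtain ⟨y, hy, rfl⟩ := mem_image.1 hb
    by_cases hjI : j ∈ (I s).map ι
    · obtain ⟨i, hi, rfl⟩ := mem_map.1 hjI
      have hfin : ∀ x, z x (ι i) = h x i := fun x => by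
        rw [← hrun', ← hz]
        refine (run_eq_of_notMem hc _ (fun g hg => hgs g (List.mem_of_mem_drop hg)) _ ?_ _).symm
        have := (hmemI s i).1 hi
        simpa only [D, List.mem_toFinset] using this
      rw [hfin, hfin]
      refine hPh x hx y hy i fun h1 => ?_
      rw [mem_sdiff, mem_inter] at h1
      exact h1.2 ⟨h1.1, hi⟩
    · have hjB : j ∉ B s := fun h1 => hj (mem_sdiff.2 ⟨h1, hjI⟩)
      have hini : ∀ x, z x j = ext x j := fun x =>
        run_eq_of_notMem hc _ (fun g hg => hgs g (List.mem_of_mem_take hg)) _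
          (by simpa only [B, List.mem_toFinset] using hjB) _
      rw [hini, hini]
      by_cases hjn : (j : ℕ) < n
      · have hji : j = ι ⟨j, hjn⟩ := by ext; simp [ι]
        rw [hji, hext, hext]
        refine hPU x hx y hy _ fun h1 => hjI ?_
        rw [hji]
        exact mem_map_of_mem ι (mem_inter.1 h1).2
      · simp [ext, hjn]
  rw [card_image_of_injOn hzinj] at hW
  have hkW := hPk _ hW
  have hsub : (I s).map ι ⊆ B s := by
    intro j hj
    obtain ⟨i, hi, rfl⟩ := mem_map.1 hj
    exact (hBD s i).resolve_right ((hmemI s i).1 hi)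
  -- The first `s` steps touch `#W + #(I s) ≥ k + #(I s)` cells, and the later ones at least `n -
  -- #(I s)`.
  have h1 : #W + #(I s) = #(B s) := by
    rw [← card_map ι]
    exact card_sdiff_add_card_eq_card hsub
  have h2 : #(B s) ≤ s := by
    refine (List.toFinset_card_le _).trans ?_
    simp
  have h3 : #(D s) ≤ gs.length - s := by
    refine (List.toFinset_card_le _).trans ?_
    simp
  have h4 : #((I s)ᶜ) ≤ #(D s) := by
    rw [← card_map ι]
    refine card_le_card fun j hj => ?_
    obtain ⟨i, hi, rfl⟩ := mem_map.1 hj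
    rw [mem_compl, hmemI, not_not] at hi
    exact hi
  rw [card_compl, Fintype.card_fin] at h4
  have h5 : #(I s) ≤ n := by simpa using card_le_univ (I s)
  omega

/-! ### Construction of a hard transformation -/

/-- Greedy choice of pairwise disjoint sets `P U` of `b + 1` configurations agreeing outside `U`. -/
theorem exists_disjoint_agree {n q k b : ℕ} (F : Finset (Finset (Fin n)))
    (hF : ∀ U ∈ F, #U = k) (hb : q ^ (n - k) * b + (#F - 1) * (b + 1) < q ^ n) :
    ∃ P : Finset (Fin n) → Finset (Config n q),
      (∀ U ∈ F, #(P U) = b + 1 ∧ ∀ x ∈ P U, ∀ y ∈ P U, ∀ i ∉ U, x i = y i) ∧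
      ∀ U ∈ F, ∀ V ∈ F, ∀ x, x ∈ P U → x ∈ P V → U = V := by
  induction F using Finset.induction_on with
  | empty => exact ⟨fun _ => ∅, by simp, by simp⟩
  | insert U F hU ih =>
    rw [card_insert_of_notMem hU, Nat.add_sub_cancel] at hb
    obtain ⟨P, hP, hdis⟩ := ih (fun V hV => hF V (mem_insert_of_mem hV))
      (lt_of_le_of_lt (by gcongr; omega) hb)
    have hUk : #U = k := hF U (mem_insert_self _ _)
    let O : Finset (Config n q) := F.biUnion P
    have hO : #O ≤ #F * (b + 1) := card_biUnion_le_card_mul _ _ _ fun V hV => (hP V hV).1.le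
    have hcard : #(univ : Finset ({i // i ∉ U} → Fin q)) * b < #(univ \ O) := by
      have h1 : #(univ \ O) = q ^ n - #O := by
        rw [card_sdiff_of_subset (subset_univ _)]
        simp
      have h2 : #(univ : Finset ({i // i ∉ U} → Fin q)) = q ^ (n - k) := by
        simp [Fintype.card_subtype_compl, hUk]
      rw [h1, h2]
      omega
    -- Pigeonhole on the `q ^ (n - k)` restrictions to the complement of `U`, among configurations
    -- not yet used.
    obtain ⟨a, -, ha⟩ := exists_lt_card_fiber_of_mul_lt_card_of_maps_to
      (f := fun (x : Config n q) (i : {i // i ∉ U}) => x i) (fun _ _ => mem_univ _) hcard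
    obtain ⟨Q, hQ, hQc⟩ := exists_subset_card_eq (Nat.succ_le_of_lt ha)
    have hQO : ∀ x ∈ Q, ∀ V ∈ F, x ∉ P V := by
      intro x hx V hV hxV
      have := (mem_filter.1 (hQ hx)).1
      rw [mem_sdiff] at this
      exact this.2 (mem_biUnion.2 ⟨V, hV, hxV⟩)
    have hne : ∀ V ∈ F, V ≠ U := fun V hV e => hU (e ▸ hV)
    have hPV : ∀ V ∈ F, Function.update P U Q V = P V := fun V hV =>
      Function.update_of_ne (hne V hV) _ _
    have hPU : Function.update P U Q U = Q := Function.update_self _ _ _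
    refine ⟨Function.update P U Q, fun V hV => ?_, fun V hV V' hV' x hx hx' => ?_⟩
    · rcases mem_insert.1 hV with rfl | hV
      · rw [hPU]
        refine ⟨hQc, fun x hx y hy i hi => ?_⟩
        have h1 := (mem_filter.1 (hQ hx)).2
        have h2 := (mem_filter.1 (hQ hy)).2
        exact congrFun (h1.trans h2.symm) ⟨i, hi⟩
      · rw [hPV V hV]
        exact hP V hV
    · rcases mem_insert.1 hV with rfl | hVF <;> rcases mem_insert.1 hV' with rfl | hVF'
      · rfl
      · rw [hPU] at hx
        rw [hPV V' hVF'] at hx'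
        exact absurd hx' (hQO x hx V' hVF')
      · rw [hPU] at hx'
        rw [hPV V hVF] at hx
        exact absurd hx (hQO x hx' V hVF)
      · rw [hPV V hVF] at hx
        rw [hPV V' hVF'] at hx'
        exact hdis V hVF V' hVF' x hx hx'

theorem le_proceduralComplexityStar {n q N : ℕ} {h : Transformation n q}
    (H : ∀ (m : ℕ) (hnm : n ≤ m) (t : ℕ), ComputedIn h hnm t → N ≤ t) :
    (N : ℕ∞) ≤ proceduralComplexityStar h :=
  le_iInf₂ fun m hnm => le_iInf₂ fun t ht => by exact_mod_cast H m hnm t ht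

/-- By symmetry a central binomial coefficient is twice `(2 * j + 1).choose j`, which is at most `4
^ j`. -/
theorem two_mul_choose_le_four_pow {k : ℕ} (hk : 1 ≤ k) : 2 * (2 * k).choose k ≤ 4 ^ k := by
  obtain ⟨j, rfl⟩ : ∃ j, k = j + 1 := ⟨k - 1, by omega⟩
  have h1 : (2 * (j + 1)).choose (j + 1) = (2 * j + 1).choose j + (2 * j + 1).choose (j + 1) :=
    Nat.choose_succ_succ (2 * j + 1) j
  have h2 := Nat.choose_symm_half j
  have h3 := Nat.choose_middle_le_pow j
  rw [pow_succ]
  omega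

theorem exists_add_le_proceduralComplexityStar {n q k : ℕ} (hn : 0 < n) (hq : 2 ≤ q)
    (hkn : 2 * k ≤ n) (h4 : 4 ^ k ≤ q ^ (n - k)) :
    ∃ h : Transformation n q, ((n + k : ℕ) : ℕ∞) ≤ proceduralComplexityStar h := by
  have : Nontrivial (Fin q) := Fin.nontrivial_iff_two_le.2 hq
  choose σ hσ using fun a : Fin q => exists_ne a
  rcases Nat.eq_zero_or_pos k with rfl | hk
  · refine ⟨fun x i => σ (x i), le_proceduralComplexityStar fun m hnm t ht =>
      add_le_of_computedIn hn (by omega) _ hnm ∅ (by simp)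
        (fun i hi => hσ _ (hi fun _ => ⟨0, by omega⟩)) (fun U _ _ => ⟨∅, by simp⟩) ht⟩
  obtain ⟨A, -, hA⟩ := exists_subset_card_eq (s := (univ : Finset (Fin n))) (n := 2 * k)
    (by simpa using hkn)
  let F := A.powersetCard k
  have hFm : ∀ U, U ∈ F ↔ U ⊆ A ∧ #U = k := fun U => mem_powersetCard
  have hFc : 2 * #F ≤ 4 ^ k := by
    rw [card_powersetCard, hA]
    exact two_mul_choose_le_four_pow hk
  -- Families of size `q ^ (k - 1) + 1` are the smallest that do not fit in `k - 1` cells. Both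
  -- summands are at most `q ^ (n - 1)`, the second strictly, and `2 ≤ q`.
  have hb : q ^ (n - k) * q ^ (k - 1) + (#F - 1) * (q ^ (k - 1) + 1) < q ^ n := by
    have e1 : q ^ n = q ^ (n - k) * q ^ (k - 1) * q := by
      rw [← pow_add, ← pow_succ]
      congr 1
      omega
    have hpos : 1 ≤ q ^ (k - 1) := Nat.one_le_pow _ _ (by omega)
    have hpos4 : 1 ≤ 4 ^ k := Nat.one_le_pow _ _ (by omega)
    have h5 : (#F - 1) * (q ^ (k - 1) + 1) ≤ (2 * (#F - 1)) * q ^ (k - 1) := by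
      calc (#F - 1) * (q ^ (k - 1) + 1) ≤ (#F - 1) * (2 * q ^ (k - 1)) := by gcongr; omega
        _ = _ := by ring
    have h6 : (2 * (#F - 1)) * q ^ (k - 1) < q ^ (n - k) * q ^ (k - 1) :=
      Nat.mul_lt_mul_of_pos_right (by omega) hpos
    have h7 : q ^ (n - k) * q ^ (k - 1) * 2 ≤ q ^ (n - k) * q ^ (k - 1) * q := by gcongr
    omega
  obtain ⟨P, hP, hdis⟩ := exists_disjoint_agree F (fun U hU => ((hFm U).1 hU).2) hb
  have hbij : ∀ U, ∃ f : Fin n → Fin n, U ∈ F → ∀ i ∈ U, ∃ j ∈ A \ U, f j = i := by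
    intro U
    by_cases hU : U ∈ F
    · have hc : #(A \ U) = #U := by
        rw [card_sdiff_of_subset ((hFm U).1 hU).1, hA, ((hFm U).1 hU).2]
        omega
      let e := equivOfCardEq hc
      refine ⟨fun j => if hj : j ∈ A \ U then e ⟨j, hj⟩ else j, fun _ i hi => ?_⟩
      refine ⟨e.symm ⟨i, hi⟩, (e.symm ⟨i, hi⟩).2, ?_⟩
      simp only [coe_mem, dif_pos, Subtype.coe_eta, Equiv.apply_symm_apply]
    · exact ⟨id, fun h => absurd h hU⟩
  choose f hf using hbij
  have hlab : ∀ x : Config n q, ∃ U, ∀ V ∈ F, x ∈ P V → V = U := by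
    intro x
    by_cases hx : ∃ U ∈ F, x ∈ P U
    · obtain ⟨U, hU, hxU⟩ := hx
      exact ⟨U, fun V hV hxV => hdis V hV U hU x hxV hxU⟩
    · exact ⟨∅, fun V hV hxV => absurd ⟨V, hV, hxV⟩ hx⟩
  choose u hu using hlab
  -- On `P U`, the content of `U` is copied bijectively to `A \ U` and `U` is erased. Outside `A`,
  -- the fixed-point-free `σ` makes every coordinate nontrivial.
  let h : Transformation n q := fun x i =>
    if i ∈ A \ u x then x (f (u x) i) else if i ∈ A then ⟨0, by omega⟩ else σ (x i)
  have hagree : ∀ U ∈ F, ∀ x ∈ P U, ∀ y ∈ P U, ∀ i ∉ A \ U, h x i = h y i := by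
    intro U hU x hx y hy i hi
    simp only [h, ← hu x U hU hx, ← hu y U hU hy, if_neg hi]
    by_cases hiA : i ∈ A
    · simp [hiA]
    · rw [if_neg hiA, if_neg hiA,
        (hP U hU).2 x hx y hy i fun hiU => hiA (((hFm U).1 hU).1 hiU)]
  have hinj : ∀ U ∈ F, Set.InjOn h (P U) := by
    intro U hU x hx y hy hxy
    funext i
    by_cases hi : i ∈ U
    · obtain ⟨j, hj, rfl⟩ := hf U hU i hi
      have h1 := congrFun hxy j
      simpa only [h, ← hu x U hU hx, ← hu y U hU hy, if_pos hj] using h1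
    · exact (hP U hU).2 x hx y hy i hi
  refine ⟨h, le_proceduralComplexityStar fun m hnm t ht =>
    add_le_of_computedIn hn (by omega) h hnm A (by omega) ?_ ?_ ht⟩
  · intro i htriv
    by_cases hiA : i ∈ A
    · obtain ⟨U, hiU, hUA, hUk⟩ := exists_subsuperset_card_eq (singleton_subset_iff.2 hiA)
        (n := k) (by rwa [card_singleton]) (by omega)
      have hU : U ∈ F := (hFm U).2 ⟨hUA, hUk⟩
      have hiU' : i ∈ U := hiU (mem_singleton_self i)
      -- `h` is constant at `i` on `P U`; were it trivial there, `P U` would vary on only `k - 1`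
      -- coordinates.
      have hle := card_le_pow_of_agree (P U) (U.erase i) fun x hx y hy j hj => by
        by_cases hji : j = i
        · subst hji
          rw [← htriv x, ← htriv y]
          exact hagree U hU x hx y hy j fun h1 => (mem_sdiff.1 h1).2 hiU'
        · exact (hP U hU).2 x hx y hy j fun h1 => hj (mem_erase.2 ⟨hji, h1⟩)
      rw [card_erase_of_mem hiU', hUk, (hP U hU).1] at hle
      omega
    · have h1 := htriv fun _ => ⟨0, by omega⟩
      have h2 : i ∉ A \ u fun _ => ⟨0, by omega⟩ := fun h3 => hiA (mem_sdiff.1 h3).1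
      simp only [h, if_neg h2, if_neg hiA] at h1
      exact hσ _ h1
  · intro U hUA hUk
    have hU : U ∈ F := (hFm U).2 ⟨hUA, hUk⟩
    refine ⟨P U, fun w hw => ?_, (hP U hU).2, hagree U hU, hinj U hU⟩
    rw [(hP U hU).1] at hw
    have := (Nat.pow_lt_pow_iff_right (by omega : 1 < q)).1 (Nat.lt_of_succ_le hw)
    omega

end AutomataNetwork

open AutomataNetwork in
theorem mainTheorem10 (n q : ℕ) (hn : 2 ≤ n) (hq : 2 ≤ q) :
    (∃ h : Transformation n q,
      ((n + n / 3 : ℕ) : ℕ∞) ≤ proceduralComplexityStar h) ∧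
    (4 ≤ q → ∃ h : Transformation n q,
      ((n + ⌊(n : ℝ) / 2 - Real.logb (q : ℝ) (n : ℝ)⌋₊ : ℕ) : ℕ∞) ≤
        proceduralComplexityStar h) := by
  refine ⟨exists_add_le_proceduralComplexityStar (by omega) hq (by omega) ?_, fun h4 => ?_⟩
  · calc 4 ^ (n / 3) = 2 ^ (2 * (n / 3)) := by rw [pow_mul]; norm_num
      _ ≤ q ^ (2 * (n / 3)) := by gcongr
      _ ≤ q ^ (n - n / 3) := Nat.pow_le_pow_right (by omega) (by omega)
  -- For `4 ≤ q` the choice `k = n / 2` is already admissible, so the logarithmic loss is simply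
  -- discarded.
  · obtain ⟨h, hh⟩ := exists_add_le_proceduralComplexityStar (n := n) (q := q) (k := n / 2)
      (by omega) hq (by omega)
      ((Nat.pow_le_pow_left h4 _).trans (Nat.pow_le_pow_right (by omega) (by omega)))
    refine ⟨h, le_trans ?_ hh⟩
    have hlog : 0 ≤ Real.logb (q : ℝ) (n : ℝ) :=
      Real.logb_nonneg (by exact_mod_cast hq) (by exact_mod_cast (by omega : 1 ≤ n))
    have hfl : ⌊(n : ℝ) / 2 - Real.logb (q : ℝ) (n : ℝ)⌋₊ ≤ n / 2 := by
      rw [← Nat.floor_div_eq_div (K := ℝ)]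
      exact Nat.floor_le_floor (by push_cast; linarith)
    exact_mod_cast Nat.add_le_add_left hfl n
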